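/- Let $K$ be an algebraically closed field and let $A$ be a finite-dimensional (associative, unital) $K$-algebra. Suppose that $\dim_K \mathrm{Ext}^1_A(S,S)=0$ for every simple right $A$-module $S$, and that $\dim_K \mathrm{Ext}^1_A(S,T)\le 1$ for all non-isomorphic simple right $A$-modules $S$ and $T$. Let $\mathrm{HH}^1(A)$ be the first Hochschild cohomology of $A$ over $K$, that is, the space of $K$-linear derivations of $A$ modulo the inner derivations, with the Lie bracket induced by the commutator of derivations. Then $\mathrm{HH}^1(A)$ is a strongly solvable Lie algebra: its derived subalgebra $[\mathrm{HH}^1(A),\mathrm{HH}^1(A)]$ is nilpotent. In particular, $\mathrm{HH}^1(A)$ is a solvable Lie algebra. -/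

import Mathlib

open CategoryTheory

universe u v

/- The bracket on an associative ring is the commutator `⁅x, y⁆ = x * y - y * x`; it is used for
the associative ring `Module.End K A` of `K`-linear endomorphisms of `A`. -/
attribute [local instance 100] LieRing.ofAssociativeRing

namespace Hochschild

section Complex

variable (K : Type u) (A : Type v) [Field K] [Ring A] [Algebra K A]

/-- The differential `C⁰(A, A) = A ⟶ C¹(A, A) = Hom_K(A, A)` of the Hochschild cochain complex,
`(δ⁰ a)(x) = x a - a x`. -/
def d0 : A →ₗ[K] Module.End K A :=
  (LinearMap.mul K A).flip - LinearMap.mul K A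

/-- The differential `C¹(A, A) = Hom_K(A, A) ⟶ C²(A, A) = Hom_K(A ⊗ A, A)` of the Hochschild
cochain complex, `(δ¹ f)(x ⊗ y) = x f(y) - f(x y) + f(x) y`; the space `Hom_K(A ⊗ A, A)` is
written as the space of bilinear maps `A → A → A`. -/
def d1 : Module.End K A →ₗ[K] (A →ₗ[K] A →ₗ[K] A) where
  toFun f := (LinearMap.mul K A).compl₂ f - (LinearMap.mul K A).compr₂ f
    + (LinearMap.mul K A).comp f
  map_add' f g := by
    ext x y
    simp [mul_add]
    abel
  map_smul' c f := by
    ext x y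
    simp [smul_add, smul_sub]

variable {K A}

@[simp]
theorem d0_apply (a x : A) : d0 K A a x = x * a - a * x := rfl

@[simp]
theorem d1_apply (f : Module.End K A) (x y : A) :
    d1 K A f x y = x * f y - f (x * y) + f x * y := rfl

/-- The `1`-cocycles are exactly the `K`-linear derivations of `A`. -/
theorem mem_ker_d1 {f : Module.End K A} :
    f ∈ LinearMap.ker (d1 K A) ↔ ∀ x y : A, f (x * y) = f x * y + x * f y := by
  rw [LinearMap.mem_ker, LinearMap.ext_iff₂]
  refine forall₂_congr fun x y => ?_
  rw [d1_apply, LinearMap.zero_apply, LinearMap.zero_apply, sub_add_eq_add_sub, sub_eq_zero,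
    add_comm, eq_comm]

theorem range_d0_le_ker_d1 : LinearMap.range (d0 K A) ≤ LinearMap.ker (d1 K A) := by
  rintro _ ⟨a, rfl⟩
  rw [mem_ker_d1]
  intro x y
  simp only [d0_apply, sub_mul, mul_sub, mul_assoc]
  abel

variable (K A)

/-- The Lie algebra `Ker δ¹` of Hochschild `1`-cocycles (that is, of derivations), with the
commutator `⁅D, E⁆ = D ∘ E - E ∘ D`. -/
def Z1 : LieSubalgebra K (Module.End K A) where
  __ := LinearMap.ker (d1 K A)
  lie_mem' := by
    intro D E hD hE
    replace hD := mem_ker_d1.1 hD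
    replace hE := mem_ker_d1.1 hE
    refine mem_ker_d1.2 fun x y => ?_
    simp only [LieRing.of_associative_ring_bracket, LinearMap.sub_apply, Module.End.mul_apply,
      hD, hE, map_add, sub_mul, mul_sub]
    abel

/-- The Lie ideal `Im δ⁰ ⊆ Ker δ¹` of Hochschild `1`-coboundaries (that is, of inner
derivations). -/
def B1 : LieIdeal K (Z1 K A) where
  __ := (LinearMap.range (d0 K A)).comap (Z1 K A).toSubmodule.subtype
  lie_mem := by
    rintro ⟨D, hD⟩ ⟨_, hE⟩ ⟨a, rfl⟩
    replace hD := mem_ker_d1.1 hD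
    refine ⟨D a, LinearMap.ext fun x => ?_⟩
    change x * D a - D a * x = D (x * a - a * x) - (D x * a - a * D x)
    rw [map_sub, hD, hD]
    abel

/-- The first Hochschild cohomology `HH¹(A) = Ker δ¹ / Im δ⁰` of the `K`-algebra `A`, with the Lie
bracket induced by the commutator of derivations. -/
abbrev HH1 : Type v := Z1 K A ⧸ B1 K A

end Complex

end Hochschild

/-- A Lie algebra `L` is strongly solvable if its derived subalgebra `[L, L]` is nilpotent (as a
Lie algebra). -/
def IsStronglySolvable (K : Type u) (L : Type v) [CommRing K] [LieRing L] [LieAlgebra K L] : Prop :=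
  LieRing.IsNilpotent (LieAlgebra.derivedSeries K L 1)

/-! Let `J` be the radical, `e i` a basic family of idempotents and `S i` the top of `e i A`. The
space `e i (J / J²) e j` is dual to `Hom(e i J, S j)`, which embeds in `Ext¹(S i, S j)`. So the
hypotheses say that `e i J e i ⊆ J²`, and that `e i (J / J²) e j` is at most a line for `i ≠ j`.
Every class in `HH¹` is represented by a derivation killing all `e i`
(`exists_derivation_apply_eq_commutator`). Such a derivation preserves each `e i A e j`. Absence of
loops forces it to preserve the radical filtration of the basic corner
(`IsBasicFamily.cornerShifts_zero`). On each line it acts by a scalar, and scalars commute, so a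
commutator raises the filtration by one (`IsBasicFamily.cornerShifts_one_lie`). Let `F k` be the
classes of derivations raising the filtration by `k`. Then `F 0` is everything, `[F a, F b] ⊆ F (a +
b)` and `[F 0, F 0] ⊆ F 1`. For large `k`, nilpotency of `J` makes these derivations vanish on the
corner, which is full, so they are inner (`exists_eq_commutator_of_corner_eq_zero`) and `F k = 0`.
Hence the derived subalgebra is nilpotent. -/

theorem isStronglySolvable_of_filtration {K : Type u} {L : Type v} [CommRing K] [LieRing L]
    [LieAlgebra K L] (F : ℕ → Submodule K L) (h₁ : ∀ x y : L, ⁅x, y⁆ ∈ F 1)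
    (hs : ∀ k, ∀ x ∈ F 1, ∀ y ∈ F k, ⁅x, y⁆ ∈ F (k + 1)) (n : ℕ) (hn : F (n + 1) = ⊥) :
    IsStronglySolvable K L := by
  have hD : ∀ x ∈ LieAlgebra.derivedSeries K L 1, x ∈ F 1 := by
    have : (LieAlgebra.derivedSeries K L 1).toSubmodule ≤ F 1 := by
      have h := LieAlgebra.coe_derivedSeries_one_eq (R := K) (L := L)
      simp only [LieIdeal.toLieSubalgebra_toSubmodule] at h
      rw [h, Submodule.span_le]
      rintro _ ⟨x, y, rfl⟩
      exact h₁ x y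
    exact this
  -- The lower central series starts at index zero with the derived subalgebra, already inside `F
  -- 1`; hence the shift by one.
  have key : ∀ k, ∀ x ∈ LieModule.lowerCentralSeries K (LieAlgebra.derivedSeries K L 1)
      (LieAlgebra.derivedSeries K L 1) k, (x : L) ∈ F (k + 1) := by
    intro k
    induction k with
    | zero => exact fun x _ => hD _ x.2
    | succ k ih =>
      intro x hx
      rw [LieModule.lowerCentralSeries_succ, ← LieSubmodule.mem_toSubmodule,
        LieSubmodule.lieIdeal_oper_eq_linear_span'] at hx
      induction hx using Submodule.span_induction with
      | mem x h =>
        obtain ⟨a, -, b, hb, rfl⟩ := h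
        exact hs _ _ (hD _ a.2) _ (ih b hb)
      | zero => exact zero_mem _
      | add x y _ _ hx hy => exact add_mem hx hy
      | smul c x _ hx => exact Submodule.smul_mem _ c hx
  refine (LieModule.isNilpotent_iff K _ _).2 ⟨n, ?_⟩
  rw [eq_bot_iff]
  intro x hx
  have := key n x hx
  rw [hn] at this
  exact (LieSubmodule.mem_bot _).2 (Subtype.ext this)

theorem IsStronglySolvable.isSolvable {K : Type u} {L : Type v} [CommRing K] [LieRing L]
    [LieAlgebra K L] (h : IsStronglySolvable K L) : LieAlgebra.IsSolvable L := by
  have : LieRing.IsNilpotent (LieAlgebra.derivedSeries K L 1) := h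
  have hs : LieAlgebra.IsSolvable (LieAlgebra.derivedSeries K L 1) := inferInstance
  obtain ⟨k, hk⟩ := (LieAlgebra.isSolvable_iff K _).1 hs
  refine (LieAlgebra.isSolvable_iff K _).2 ⟨k + 1, ?_⟩
  rw [LieAlgebra.derivedSeries_def, LieAlgebra.derivedSeriesOfIdeal_add]
  exact (LieIdeal.derivedSeries_eq_bot_iff _ k).1 hk

/-- A finite family `e` of orthogonal idempotents of `A` representing, modulo the two-sided ideal
`J`, each isomorphism class of simple modules of the split semisimple algebra `A / J` exactly
once. The corner ring of `A` at `∑ i, e i` is then the basic algebra of `A`. -/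
structure IsBasicFamily (K : Type*) {A ι : Type*} [Field K] [Ring A] [Algebra K A] [Fintype ι]
    (J : Ideal A) (e : ι → A) : Prop where
  orthogonal : OrthogonalIdempotents e
  mul_mul_mem : ∀ i j, i ≠ j → ∀ x, e i * x * e j ∈ J
  exists_smul : ∀ i x, ∃ c : K, e i * x * e i - c • e i ∈ J
  notMem : ∀ i, e i ∉ J
  exists_mul : ∀ i x, e i * x ∉ J → ∃ y, e i * x * y - e i ∈ J
  full : ∃ (m : ℕ) (x y : Fin m → A), ∑ k, x k * (∑ i, e i) * y k = 1

theorem Ideal.mul_mem_pow_of_add_eq {A : Type*} [Ring A] {J : Ideal A} [J.IsTwoSided] {a b c : ℕ}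
    (h : a + b = c) {x y : A} (hx : x ∈ J ^ a) (hy : y ∈ J ^ b) : x * y ∈ J ^ c := by
  rw [← h, Ideal.IsTwoSided.pow_add]
  exact Ideal.mul_mem_mul hx hy

theorem Ideal.mul_mul_mem_of_isTwoSided {A : Type*} [Ring A] {J : Ideal A} [J.IsTwoSided]
    {x : A} (hx : x ∈ J) (a b : A) : a * x * b ∈ J :=
  J.mul_mem_right _ (J.mul_mem_left _ hx)

/-! ### Derivations and the radical filtration of a full corner -/

section Derivation

variable {K : Type*} {A : Type*} [Field K] [Ring A] [Algebra K A] {f g : Module.End K A}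

/-- Modulo inner derivations, a derivation vanishes on given orthogonal idempotents. -/
theorem exists_derivation_apply_eq_commutator {ι : Type*} [Fintype ι] {e : ι → A}
    (he : OrthogonalIdempotents e) (hf : ∀ x y, f (x * y) = f x * y + x * f y) :
    ∃ a, ∀ i, f (e i) = a * e i - e i * a := by
  classical
  -- Adjoining `1 - ∑ i, e i` makes the family complete, so that `a = ∑ j, f (E j) * E j` works:
  -- Leibniz on `E i * E j` gives `E i * a = f (E i) * E i - f (E i)`, while `a * E i = f (E i) * E
  -- i`.
  have hc := CompleteOrthogonalIdempotents.option he
  generalize hE : (Option.elim · (1 - ∑ i, e i) e) = E at hc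
  have hEi : ∀ i, e i = E (some i) := fun i => by rw [← hE]; rfl
  refine ⟨∑ j, f (E j) * E j, fun i => ?_⟩
  rw [hEi, Finset.sum_mul, Finset.mul_sum]
  have h1 : ∀ j, f (E j) * E j * E (some i) = if j = some i then f (E (some i)) * E (some i)
      else 0 := by
    intro j
    rw [mul_assoc, hc.mul_eq]
    split_ifs with h
    · rw [h]
    · rw [mul_zero]
  have h2 : ∀ j, E (some i) * (f (E j) * E j) =
      (if j = some i then f (E (some i)) * E (some i) else 0) - f (E (some i)) * E j := by
    intro j
    have h := hf (E (some i)) (E j)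
    rw [← mul_assoc, eq_sub_iff_add_eq, add_comm,
      show f (E (some i)) * E j = f (E (some i)) * E j * E j by rw [mul_assoc, hc.idem j],
      ← add_mul, ← h, hc.mul_eq]
    by_cases hj : some i = j
    · subst hj; simp
    · rw [if_neg hj, if_neg (Ne.symm hj)]; simp
  simp only [h1, h2, Finset.sum_sub_distrib, ← Finset.mul_sum, hc.complete, mul_one]
  abel

/-- A derivation vanishing on a full corner `e A e` is inner. -/
theorem exists_eq_commutator_of_corner_eq_zero (hf : ∀ x y, f (x * y) = f x * y + x * f y)
    {e : A} (he : e * e = e) (hfe : f e = 0) (hc : ∀ x, f (e * x * e) = 0) {m : ℕ}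
    {x y : Fin m → A} (hxy : ∑ k, x k * e * y k = 1) : ∃ a, ∀ z, f z = a * z - z * a := by
  refine ⟨∑ k, f (x k * e) * y k, fun z => ?_⟩
  -- Left multiplication by the witness agrees with `f` on `A e`: expand `w e` by fullness and use
  -- that `f` kills the corner. Leibniz on `z * (w e)` then gives the claim on `A e`, and `A e A =
  -- A` gives it everywhere.
  have hA : ∀ w, (∑ k, f (x k * e) * y k) * (w * e) = f (w * e) := by
    intro w
    have : w * e = ∑ k, x k * e * (e * (y k * w) * e) := by
      conv_lhs => rw [← one_mul w, ← hxy, Finset.sum_mul, Finset.sum_mul]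
      refine Finset.sum_congr rfl fun k _ => ?_
      rw [show x k * e * (e * (y k * w) * e) = x k * (e * e) * y k * w * e by
        simp only [mul_assoc], he]
    conv_rhs => rw [this, map_sum]
    rw [Finset.sum_mul]
    refine Finset.sum_congr rfl fun k _ => ?_
    rw [hf _ (e * (y k * w) * e), hc, mul_zero, add_zero, hf, hfe, mul_zero, add_zero]
    rw [show f (x k) * e * (e * (y k * w) * e) = f (x k) * (e * e) * (y k * w) * e by
        simp only [mul_assoc], he]
    simp only [mul_assoc]
  generalize (∑ k, f (x k * e) * y k) = a at hA
  have hz : ∀ w, f z * (w * e) = (a * z - z * a) * (w * e) := by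
    intro w
    have h := hf z (w * e)
    rw [← mul_assoc z, ← hA, ← hA] at h
    rw [sub_mul, mul_assoc z, mul_assoc a, ← mul_assoc z, h, add_sub_cancel_right]
  rw [← mul_one (f z), ← mul_one (a * z - z * a), ← hxy, Finset.mul_sum, Finset.mul_sum]
  exact Finset.sum_congr rfl fun k _ => by rw [← mul_assoc, hz, mul_assoc]

/-- `f` maps `e Jʲ e` to `Jʲ⁺ᵏ` for all `j`. -/
def CornerShifts (J : Ideal A) (e : A) (k : ℕ) (f : Module.End K A) : Prop :=
  ∀ j, ∀ x ∈ J ^ j, f (e * x * e) ∈ J ^ (j + k)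

theorem apply_idem_mul_mul (hf : ∀ x y, f (x * y) = f x * y + x * f y) {a b : A}
    (ha : f a = 0) (hb : f b = 0) (x : A) : f (a * x * b) = a * f x * b := by
  rw [hf, hf, ha, hb, zero_mul, mul_zero, zero_add, add_zero]

section Corner

variable {J : Ideal A} [J.IsTwoSided] {e : A}

/-- Since `A e A = A`, elements of `e Jʲ⁺¹ e` are sums of products from `e J e` and `e Jʲ e`, so
Leibniz propagates the bound from degrees zero and one. -/
theorem cornerShifts_of_zero_of_one (hf : ∀ x y, f (x * y) = f x * y + x * f y)
    (he : e * e = e) {m : ℕ} {x y : Fin m → A} (hxy : ∑ k, x k * e * y k = 1) {k : ℕ}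
    (h₀ : ∀ x, f (e * x * e) ∈ J ^ k) (h₁ : ∀ x ∈ J, f (e * x * e) ∈ J ^ (k + 1)) :
    CornerShifts J e k f := by
  intro j
  induction j with
  | zero => intro x _; rw [zero_add]; exact h₀ x
  | succ j ih =>
    intro z hz
    rw [Ideal.IsTwoSided.pow_succ] at hz
    refine Submodule.mul_induction_on hz (fun a ha b hb => ?_) fun a b ha hb => ?_
    · have : e * (a * b) * e = ∑ l, (e * (a * x l) * e) * (e * (y l * b) * e) := by
        conv_lhs => rw [← mul_one a, ← hxy, Finset.mul_sum, Finset.sum_mul, Finset.mul_sum,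
          Finset.sum_mul]
        refine Finset.sum_congr rfl fun l _ => ?_
        rw [show (e * (a * x l) * e) * (e * (y l * b) * e)
          = e * (a * x l) * (e * e) * (y l * b) * e by simp only [mul_assoc], he]
        simp only [mul_assoc]
      rw [this, map_sum]
      refine Ideal.sum_mem _ fun l _ => ?_
      rw [hf]
      refine add_mem (Ideal.mul_mem_pow_of_add_eq (a := k + 1) (b := j) (by omega)
        (h₁ _ (J.mul_mem_right _ ha)) ?_) (Ideal.mul_mem_pow_of_add_eq (a := 1) (b := j + k)
        (by omega) ?_ (ih _ ((J ^ j).mul_mem_left _ hb)))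
      · exact Ideal.mul_mul_mem_of_isTwoSided ((J ^ j).mul_mem_left _ hb) _ _
      · rw [Submodule.pow_one]
        exact Ideal.mul_mul_mem_of_isTwoSided (J.mul_mem_right _ ha) _ _
    · rw [mul_add, add_mul, map_add]
      exact add_mem ha hb

omit [J.IsTwoSided] in
theorem CornerShifts.lie {a b : ℕ} (hf : ∀ x y, f (x * y) = f x * y + x * f y)
    (hg : ∀ x y, g (x * y) = g x * y + x * g y) (he : e * e = e) (hfe : f e = 0) (hge : g e = 0)
    (hfs : CornerShifts J e a f) (hgs : CornerShifts J e b g) :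
    CornerShifts J e (a + b) ⁅f, g⁆ := by
  -- A derivation killing `e` maps the corner to itself, so the second derivation may be applied to
  -- its values.
  have aux : ∀ {f : Module.End K A}, (∀ x y, f (x * y) = f x * y + x * f y) → f e = 0 → ∀ x,
      f (e * x * e) = e * f (e * x * e) * e := by
    intro f hf hfe x
    rw [← apply_idem_mul_mul hf hfe hfe]
    congr 1
    rw [show e * (e * x * e) * e = (e * e) * x * (e * e) by simp only [mul_assoc], he]
  intro j x hx
  rw [LieRing.of_associative_ring_bracket, LinearMap.sub_apply, Module.End.mul_apply,
    Module.End.mul_apply]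
  refine sub_mem ?_ ?_
  · rw [aux hg hge, add_comm a b, ← add_assoc]
    exact hfs _ _ (hgs _ _ hx)
  · rw [aux hf hfe, ← add_assoc]
    exact hgs _ _ (hfs _ _ hx)

end Corner

section Basic

variable {J : Ideal A} [J.IsTwoSided] {ι : Type*} [Fintype ι] {e : ι → A}

/-- A derivation need not preserve `J`, but Leibniz sends `J²` into `J`, which settles the diagonal
in the absence of loops. Off the diagonal, all of `e i A e j` lies in `J` and is preserved. -/
theorem IsBasicFamily.apply_mem (he : IsBasicFamily K J e)
    (hloop : ∀ i, ∀ x ∈ J, e i * x * e i ∈ J ^ 2)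
    (hf : ∀ x y, f (x * y) = f x * y + x * f y) (hfe : ∀ i, f (e i) = 0) (i j : ι) {x : A}
    (hx : x ∈ J) : f (e i * x * e j) ∈ J := by
  by_cases hij : i = j
  · subst hij
    have h := hloop i x hx
    generalize e i * x * e i = y at h
    rw [Submodule.pow_succ, Submodule.pow_one] at h
    refine Submodule.mul_induction_on h (fun a ha b hb => ?_) fun a b ha hb => ?_
    · rw [hf]
      exact add_mem (J.mul_mem_left _ hb) (J.mul_mem_right _ ha)
    · rw [map_add]
      exact add_mem ha hb
  · rw [apply_idem_mul_mul hf (hfe i) (hfe j)]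
    exact he.mul_mul_mem i j hij _

theorem sum_mul_mul_sum (x : A) :
    (∑ i, e i) * x * (∑ j, e j) = ∑ i, ∑ j, e i * x * e j := by
  simp only [Finset.sum_mul, Finset.mul_sum]
  exact Finset.sum_comm

theorem IsBasicFamily.cornerShifts_zero (he : IsBasicFamily K J e)
    (hloop : ∀ i, ∀ x ∈ J, e i * x * e i ∈ J ^ 2)
    (hf : ∀ x y, f (x * y) = f x * y + x * f y) (hfe : ∀ i, f (e i) = 0) :
    CornerShifts J (∑ i, e i) 0 f := by
  obtain ⟨m, x, y, hxy⟩ := he.full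
  refine cornerShifts_of_zero_of_one hf he.orthogonal.isIdempotentElem_sum hxy (fun x => ?_)
    fun x hx => ?_
  · rw [Submodule.pow_zero, Ideal.one_eq_top]
    exact Submodule.mem_top
  · rw [zero_add, Submodule.pow_one, sum_mul_mul_sum, map_sum]
    refine Ideal.sum_mem _ fun i _ => ?_
    rw [map_sum]
    exact Ideal.sum_mem _ fun j _ => he.apply_mem hloop hf hfe i j hx

omit [J.IsTwoSided] in
theorem CornerShifts.apply_mem {k : ℕ} (hfs : CornerShifts J (∑ i, e i) k f)
    (he : OrthogonalIdempotents e) (i j : ι) {l : ℕ} {x : A} (hx : e i * x * e j ∈ J ^ l) :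
    f (e i * x * e j) ∈ J ^ (l + k) := by
  have h := hfs l _ hx
  have hi : (∑ k, e k) * e i = e i := by
    rw [Finset.sum_mul, Finset.sum_eq_single i (fun k _ hk => he.ortho hk) (by simp), he.idem i]
  rwa [mul_assoc (e i), ← mul_assoc _ (e i), hi, ← mul_assoc,
    mul_assoc _ (e j), he.mul_sum_of_mem (Finset.mem_univ j)] at h

theorem idem_mul_mul_mul {a b : A} (ha : a * a = a) (hb : b * b = b) (x : A) :
    a * (a * x * b) * b = a * x * b := by
  rw [mul_assoc, mul_assoc, hb, ← mul_assoc, ← mul_assoc, ha]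

/-- The scalar is read off on the generator `e i y e j`; the rest of the component is a multiple of
it modulo `J²`, which `f` preserves on the corner. -/
theorem exists_sub_smul_mem_sq (hfs : CornerShifts J (∑ i, e i) 0 f)
    (he : OrthogonalIdempotents e) (hf : ∀ x y, f (x * y) = f x * y + x * f y)
    (hfe : ∀ i, f (e i) = 0) {i j : ι}
    (hdim : ∃ y ∈ J, ∀ x ∈ J, ∃ c : K, e i * x * e j - c • (e i * y * e j) ∈ J ^ 2) :
    ∃ a : K, ∀ x, e i * x * e j ∈ J → f (e i * x * e j) - a • (e i * x * e j) ∈ J ^ 2 := by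
  obtain ⟨y, hy, h⟩ := hdim
  have hJ : ∀ x, e i * x * e j ∈ J → f (e i * x * e j) ∈ J := fun x hx => by
    have := hfs.apply_mem he i j (l := 1) (x := x) (by rwa [Submodule.pow_one])
    rwa [add_zero, Submodule.pow_one] at this
  obtain ⟨a, ha⟩ := h _ (hJ y (Ideal.mul_mul_mem_of_isTwoSided hy _ _))
  rw [← apply_idem_mul_mul hf (hfe i) (hfe j), idem_mul_mul_mul (he.idem i) (he.idem j)] at ha
  refine ⟨a, fun x hx => ?_⟩
  obtain ⟨c, hc⟩ := h _ hx
  rw [idem_mul_mul_mul (he.idem i) (he.idem j)] at hc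
  have hs : f (e i * x * e j - c • (e i * y * e j)) ∈ J ^ 2 := by
    have h' : e i * x * e j - c • (e i * y * e j) = e i * (x - c • y) * e j := by
      rw [mul_sub, sub_mul, mul_smul_comm, smul_mul_assoc]
    rw [h'] at hc ⊢
    exact hfs.apply_mem he i j hc
  have : f (e i * x * e j) - a • (e i * x * e j) = f (e i * x * e j - c • (e i * y * e j))
      + c • (f (e i * y * e j) - a • (e i * y * e j))
      - a • (e i * x * e j - c • (e i * y * e j)) := by
    rw [map_sub, map_smul, smul_sub, smul_sub, smul_comm c a]
    abel
  rw [this]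
  exact sub_mem (add_mem hs (Submodule.smul_of_tower_mem _ c ha))
    (Submodule.smul_of_tower_mem _ a hc)

/-- On the arrow space `e i (J / J²) e j` of dimension at most one, `f` and `g` act by scalars. -/
theorem lie_apply_mem_sq (hfs : CornerShifts J (∑ i, e i) 0 f)
    (hgs : CornerShifts J (∑ i, e i) 0 g) (he : OrthogonalIdempotents e)
    (hf : ∀ x y, f (x * y) = f x * y + x * f y) (hg : ∀ x y, g (x * y) = g x * y + x * g y)
    (hfe : ∀ i, f (e i) = 0) (hge : ∀ i, g (e i) = 0) {i j : ι}
    (hdim : ∃ y ∈ J, ∀ x ∈ J, ∃ c : K, e i * x * e j - c • (e i * y * e j) ∈ J ^ 2) {x : A}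
    (hx : e i * x * e j ∈ J) : ⁅f, g⁆ (e i * x * e j) ∈ J ^ 2 := by
  obtain ⟨a, ha⟩ := exists_sub_smul_mem_sq hfs he hf hfe hdim
  obtain ⟨b, hb⟩ := exists_sub_smul_mem_sq hgs he hg hge hdim
  have aux : ∀ {f : Module.End K A}, CornerShifts J (∑ i, e i) 0 f →
      (∀ x y, f (x * y) = f x * y + x * f y) → (∀ i, f (e i) = 0) →
      e i * f (e i * x * e j) * e j ∈ J := fun {f} hfs hf hfe => by
    rw [← apply_idem_mul_mul hf (hfe i) (hfe j), idem_mul_mul_mul (he.idem i) (he.idem j)]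
    have := hfs.apply_mem he i j (l := 1) (x := x) (by rwa [Submodule.pow_one])
    rwa [add_zero, Submodule.pow_one] at this
  have h1 := ha _ (aux hgs hg hge)
  have h2 := hb _ (aux hfs hf hfe)
  rw [← apply_idem_mul_mul hg (hge i) (hge j), idem_mul_mul_mul (he.idem i) (he.idem j)] at h1
  rw [← apply_idem_mul_mul hf (hfe i) (hfe j), idem_mul_mul_mul (he.idem i) (he.idem j)] at h2
  have h3 := ha _ hx
  have h4 := hb _ hx
  generalize e i * x * e j = z at *
  -- Modulo `J²`, both `f (g z)` and `g (f z)` are `a b z`; the identity records the error terms.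
  have : ⁅f, g⁆ z = (f (g z) - a • g z) - (g (f z) - b • f z) + a • (g z - b • z)
      - b • (f z - a • z) := by
    rw [LieRing.of_associative_ring_bracket, LinearMap.sub_apply, Module.End.mul_apply,
      Module.End.mul_apply, smul_sub, smul_sub, smul_comm a b]
    abel
  rw [this]
  exact sub_mem (add_mem (sub_mem h1 h2) (Submodule.smul_of_tower_mem _ a h4))
    (Submodule.smul_of_tower_mem _ b h3)

theorem lie_apply_mul {f g : Module.End K A} (hf : ∀ x y, f (x * y) = f x * y + x * f y)
    (hg : ∀ x y, g (x * y) = g x * y + x * g y) (x y : A) :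
    ⁅f, g⁆ (x * y) = ⁅f, g⁆ x * y + x * ⁅f, g⁆ y := by
  simp only [LieRing.of_associative_ring_bracket, LinearMap.sub_apply, Module.End.mul_apply,
    hf, hg, map_add, sub_mul, mul_sub]
  abel

/-- Degree one holds because scalars commute. Degree zero reduces to it: off-diagonal components lie
in `J`, and on the diagonal `e i A e i = K e i + e i J e i` with `e i` killed. -/
theorem IsBasicFamily.cornerShifts_one_lie (he : IsBasicFamily K J e)
    (hdim : ∀ i j, ∃ y ∈ J, ∀ x ∈ J, ∃ c : K, e i * x * e j - c • (e i * y * e j) ∈ J ^ 2)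
    (hfs : CornerShifts J (∑ i, e i) 0 f) (hgs : CornerShifts J (∑ i, e i) 0 g)
    (hf : ∀ x y, f (x * y) = f x * y + x * f y) (hg : ∀ x y, g (x * y) = g x * y + x * g y)
    (hfe : ∀ i, f (e i) = 0) (hge : ∀ i, g (e i) = 0) :
    CornerShifts J (∑ i, e i) 1 ⁅f, g⁆ := by
  have ho := he.orthogonal
  have key : ∀ i j x, e i * x * e j ∈ J → ⁅f, g⁆ (e i * x * e j) ∈ J ^ 2 := fun i j x hx =>
    lie_apply_mem_sq hfs hgs ho hf hg hfe hge (hdim i j) hx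
  have hle : ∀ x ∈ J ^ 2, x ∈ J := by
    intro x hx
    rw [Submodule.pow_succ, Submodule.pow_one] at hx
    exact Ideal.mul_le_right hx
  obtain ⟨m, x, y, hxy⟩ := he.full
  refine cornerShifts_of_zero_of_one (lie_apply_mul hf hg) ho.isIdempotentElem_sum hxy
    (fun x => ?_) fun x hx => ?_
  · rw [Submodule.pow_one, sum_mul_mul_sum, map_sum]
    refine Ideal.sum_mem _ fun i _ => ?_
    rw [map_sum]
    refine Ideal.sum_mem _ fun j _ => ?_
    by_cases hij : i = j
    · subst hij
      obtain ⟨c, hc⟩ := he.exists_smul i x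
      have h' : e i * x * e i - c • e i = e i * (x - c • 1) * e i := by
        rw [mul_sub, sub_mul, mul_smul_comm, smul_mul_assoc, mul_one, ho.idem i]
      have h'' : ⁅f, g⁆ (e i) = 0 := by
        rw [LieRing.of_associative_ring_bracket, LinearMap.sub_apply, Module.End.mul_apply,
          Module.End.mul_apply, hfe, hge, map_zero, map_zero, sub_zero]
      rw [← sub_add_cancel (e i * x * e i) (c • e i), map_add, map_smul, h'', smul_zero, add_zero]
      rw [h'] at hc ⊢
      exact hle _ (key _ _ _ hc)
    · exact hle _ (key _ _ _ (he.mul_mul_mem i j hij x))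
  · rw [sum_mul_mul_sum, map_sum]
    refine Ideal.sum_mem _ fun i _ => ?_
    rw [map_sum]
    exact Ideal.sum_mem _ fun j _ => key _ _ _ (Ideal.mul_mul_mem_of_isTwoSided hx _ _)

end Basic

end Derivation

/-! ### The filtration on first Hochschild cohomology -/

namespace Hochschild

variable {K : Type u} {A : Type v} [Field K] [Ring A] [Algebra K A]

theorem mem_Z1 {f : Module.End K A} : f ∈ Z1 K A ↔ ∀ x y : A, f (x * y) = f x * y + x * f y :=
  mem_ker_d1

theorem mk_eq_mk {f g : Z1 K A} :
    (LieSubmodule.Quotient.mk f : HH1 K A) = LieSubmodule.Quotient.mk g ↔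
      ∃ a, ∀ x, f.1 x - g.1 x = a * x - x * a := by
  refine (Submodule.Quotient.eq (B1 K A).toSubmodule).trans ?_
  constructor
  · rintro ⟨a, ha⟩
    refine ⟨-a, fun x => ?_⟩
    rw [neg_mul, mul_neg, sub_neg_eq_add, neg_add_eq_sub]
    exact (LinearMap.congr_fun ha x).symm
  · rintro ⟨a, ha⟩
    refine ⟨-a, LinearMap.ext fun x => ?_⟩
    change x * -a - -a * x = f.1 x - g.1 x
    rw [ha, mul_neg, neg_mul, sub_neg_eq_add, neg_add_eq_sub]

section Filtration

variable {ι : Type*} [Fintype ι]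

/-- The classes of derivations vanishing on all `e i` and shifting the `J`-adic filtration of the
corner at `∑ i, e i` by `k`. -/
def cornerFiltration (J : Ideal A) (e : ι → A) (k : ℕ) : Submodule K (HH1 K A) where
  carrier := {h | ∃ f : Z1 K A, (∀ i, f.1 (e i) = 0) ∧ CornerShifts J (∑ i, e i) k f.1 ∧
    LieSubmodule.Quotient.mk f = h}
  add_mem' := by
    rintro _ _ ⟨f, hf, hfs, rfl⟩ ⟨g, hg, hgs, rfl⟩
    exact ⟨f + g, fun i => by simp [hf, hg], fun j x hx => add_mem (hfs j x hx) (hgs j x hx), rfl⟩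
  zero_mem' := ⟨0, fun i => by simp, fun j x hx => zero_mem _, rfl⟩
  smul_mem' := by
    rintro c _ ⟨f, hf, hfs, rfl⟩
    exact ⟨c • f, fun i => by simp [hf],
      fun j x hx => Submodule.smul_of_tower_mem _ c (hfs j x hx), rfl⟩

variable {J : Ideal A} {e : ι → A}

theorem cornerFiltration_lie (he : OrthogonalIdempotents e) {a b : ℕ} {x y : HH1 K A}
    (hx : x ∈ cornerFiltration J e a) (hy : y ∈ cornerFiltration J e b) :
    ⁅x, y⁆ ∈ cornerFiltration J e (a + b) := by
  obtain ⟨f, hf, hfs, rfl⟩ := hx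
  obtain ⟨g, hg, hgs, rfl⟩ := hy
  refine ⟨⁅f, g⁆, fun i => ?_, ?_, rfl⟩
  · rw [LieSubalgebra.coe_bracket, LieRing.of_associative_ring_bracket, LinearMap.sub_apply,
      Module.End.mul_apply, Module.End.mul_apply, hf, hg, map_zero, map_zero, sub_zero]
  · have h0 : ∀ {f : Module.End K A}, (∀ i, f (e i) = 0) → f (∑ i, e i) = 0 := fun h => by
      rw [map_sum]; exact Finset.sum_eq_zero fun i _ => h i
    exact CornerShifts.lie (mem_Z1.1 f.2) (mem_Z1.1 g.2) he.isIdempotentElem_sum (h0 hf) (h0 hg)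
      hfs hgs

variable [J.IsTwoSided]

theorem mem_cornerFiltration_zero (he : IsBasicFamily K J e)
    (hloop : ∀ i, ∀ x ∈ J, e i * x * e i ∈ J ^ 2) (h : HH1 K A) :
    ∃ f : Z1 K A, (∀ i, f.1 (e i) = 0) ∧ CornerShifts J (∑ i, e i) 0 f.1 ∧
      LieSubmodule.Quotient.mk f = h := by
  obtain ⟨f, rfl⟩ := LieSubmodule.Quotient.surjective_mk' _ h
  obtain ⟨a, ha⟩ := exists_derivation_apply_eq_commutator he.orthogonal (mem_Z1.1 f.2)
  -- On `e i` the coboundary of `a` is `-f (e i)`, so adding it to `f` kills the idempotents.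
  obtain ⟨g, hg⟩ : ∃ g : Z1 K A, ∀ x, g.1 x = f.1 x + (x * a - a * x) :=
    ⟨⟨f.1 + d0 K A a, add_mem f.2 (range_d0_le_ker_d1 ⟨a, rfl⟩)⟩, fun x => rfl⟩
  have hge : ∀ i, g.1 (e i) = 0 := fun i => by rw [hg, ha]; abel
  refine ⟨g, hge, he.cornerShifts_zero hloop (mem_Z1.1 g.2) hge, mk_eq_mk.2 ⟨-a, fun x => ?_⟩⟩
  rw [hg, neg_mul, mul_neg]
  abel

theorem isStronglySolvable_HH1 (he : IsBasicFamily K J e)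
    (hloop : ∀ i, ∀ x ∈ J, e i * x * e i ∈ J ^ 2)
    (hdim : ∀ i j, i ≠ j →
      ∃ y ∈ J, ∀ x ∈ J, ∃ c : K, e i * x * e j - c • (e i * y * e j) ∈ J ^ 2)
    {n : ℕ} (hn : J ^ n = ⊥) : IsStronglySolvable K (HH1 K A) := by
  have hdim' : ∀ i j, ∃ y ∈ J, ∀ x ∈ J, ∃ c : K,
      e i * x * e j - c • (e i * y * e j) ∈ J ^ 2 := fun i j => by
    by_cases hij : i = j
    · subst hij
      exact ⟨0, zero_mem _, fun x hx => ⟨0, by rw [zero_smul, sub_zero]; exact hloop i x hx⟩⟩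
    · exact hdim i j hij
  refine isStronglySolvable_of_filtration (cornerFiltration J e) (fun x y => ?_)
    (fun k x hx y hy => add_comm 1 k ▸ cornerFiltration_lie he.orthogonal hx hy) n ?_
  · obtain ⟨f, hf, hfs, rfl⟩ := mem_cornerFiltration_zero he hloop x
    obtain ⟨g, hg, hgs, rfl⟩ := mem_cornerFiltration_zero he hloop y
    refine ⟨⁅f, g⁆, fun i => ?_, ?_, rfl⟩
    · rw [LieSubalgebra.coe_bracket, LieRing.of_associative_ring_bracket, LinearMap.sub_apply,
        Module.End.mul_apply, Module.End.mul_apply, hf, hg, map_zero, map_zero, sub_zero]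
    · exact he.cornerShifts_one_lie hdim' hfs hgs (mem_Z1.1 f.2) (mem_Z1.1 g.2) hf hg
  -- A derivation in degree `n + 1` sends the corner into `Jⁿ⁺¹ = 0`, hence is inner.
  · rw [eq_bot_iff]
    rintro _ ⟨f, hf, hfs, rfl⟩
    obtain ⟨m, x, y, hxy⟩ := he.full
    have hfe : f.1 (∑ i, e i) = 0 := by
      rw [map_sum]; exact Finset.sum_eq_zero fun i _ => hf i
    obtain ⟨a, ha⟩ := exists_eq_commutator_of_corner_eq_zero (mem_Z1.1 f.2)
      he.orthogonal.isIdempotentElem_sum hfe (fun z => by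
        have h := hfs 0 z (by rw [Submodule.pow_zero, Ideal.one_eq_top]; exact Submodule.mem_top)
        rw [zero_add, Submodule.pow_succ, hn, Ideal.bot_mul] at h
        exact h) hxy
    exact (Submodule.mem_bot K).2 ((mk_eq_mk (g := 0)).2 ⟨a, fun z => by
      rw [ha]; exact sub_zero _⟩)

end Filtration

end Hochschild

/-! ### Corner matrix units in a product of matrix algebras -/

section MatrixIdempotents

variable {K : Type*} [Field K] {n : ℕ} {d : Fin n → ℕ} [∀ i, NeZero (d i)]

theorem orthogonalIdempotents_single_zero :
    OrthogonalIdempotents fun i : Fin n =>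
      (Pi.single i (Matrix.single 0 0 1) : ∀ i, Matrix (Fin (d i)) (Fin (d i)) K) where
  idem i := by
    change _ * _ = _
    rw [← Pi.single_mul, Matrix.single_mul_single_same, one_mul]
  ortho i j hij := by
    funext k
    by_cases h : k = i
    · subst h; simp [Pi.single_eq_of_ne hij]
    · simp [Pi.single_eq_of_ne h]

theorem single_zero_mul_mul_single_zero_of_ne {i j : Fin n} (hij : i ≠ j)
    (x : ∀ i, Matrix (Fin (d i)) (Fin (d i)) K) :
    Pi.single i (Matrix.single 0 0 1) * x * Pi.single j (Matrix.single 0 0 1) = 0 := by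
  funext k
  by_cases h : k = i
  · subst h; simp [Pi.single_eq_of_ne hij]
  · simp [Pi.single_eq_of_ne h]

theorem single_zero_mul_mul_single_zero (i : Fin n)
    (x : ∀ i, Matrix (Fin (d i)) (Fin (d i)) K) :
    Pi.single i (Matrix.single 0 0 1) * x * Pi.single i (Matrix.single 0 0 1)
      = x i 0 0 • (Pi.single i (Matrix.single 0 0 1) :
        ∀ i, Matrix (Fin (d i)) (Fin (d i)) K) := by
  funext k
  by_cases h : k = i
  · subst h; simp
  · simp [Pi.single_eq_of_ne h]

theorem exists_single_zero_mul_mul_eq (i : Fin n) (x : ∀ i, Matrix (Fin (d i)) (Fin (d i)) K)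
    (hx : Pi.single i (Matrix.single 0 0 1) * x ≠ 0) :
    ∃ y, Pi.single i (Matrix.single 0 0 1) * x * y = Pi.single i (Matrix.single 0 0 1) := by
  obtain ⟨k, hk⟩ : ∃ k, x i 0 k ≠ 0 := by
    by_contra! h
    refine hx ?_
    funext l
    by_cases hl : l = i
    · subst hl
      ext a b
      rcases eq_or_ne a 0 with rfl | ha
      · simp [h]
      · simp [ha]
    · simp [Pi.single_eq_of_ne hl]
  -- The product with `x` on the left only sees row `0` of block `i`; this unit moves its nonzero
  -- entry to position `(0, 0)` and normalises it.
  refine ⟨Pi.single i (Matrix.single k 0 (x i 0 k)⁻¹), ?_⟩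
  funext l
  by_cases hl : l = i
  · subst hl; simp [hk]
  · simp [Pi.single_eq_of_ne hl]

/-- In each block `E_k0 E_00 E_0k = E_kk`, and the diagonal units sum to one. This is fullness in
the semisimple quotient. -/
theorem sum_single_mul_sum_mul_single :
    ∑ p : Σ i : Fin n, Fin (d i), Pi.single p.1 (Matrix.single p.2 0 1) *
      (∑ i, Pi.single i (Matrix.single 0 0 1)) * Pi.single p.1 (Matrix.single 0 p.2 1) =
        (1 : ∀ i, Matrix (Fin (d i)) (Fin (d i)) K) := by
  have h : ∀ p : Σ i : Fin n, Fin (d i), Pi.single p.1 (Matrix.single p.2 0 1) *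
      (∑ i, Pi.single i (Matrix.single 0 0 1)) * Pi.single p.1 (Matrix.single 0 p.2 1) =
        (Pi.single p.1 (Matrix.single p.2 p.2 1) : ∀ i, Matrix (Fin (d i)) (Fin (d i)) K) := by
    rintro ⟨i, k⟩
    funext l
    by_cases hl : l = i
    · subst hl; simp [Finset.sum_apply]
    · simp [Pi.single_eq_of_ne hl]
  rw [Finset.sum_congr rfl fun p _ => h p, Fintype.sum_sigma]
  funext l
  rw [Finset.sum_apply, Finset.sum_eq_single l]
  · rw [Finset.sum_apply]
    simp only [Pi.single_eq_same, Pi.one_apply]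
    ext a b
    rw [Matrix.sum_apply, Matrix.one_apply]
    simp only [Matrix.single_apply]
    split_ifs with h
    · subst h; simp
    · exact Finset.sum_eq_zero fun k _ => if_neg fun hk => h (hk.1.symm.trans hk.2)
  · intro i _ hi
    simp [Finset.sum_apply, Pi.single_eq_of_ne (Ne.symm hi)]
  · simp

end MatrixIdempotents

/-- The quotient by the radical is a product of matrix algebras, where one diagonal unit per block
has the required properties. These idempotents lift along the nilpotent kernel, and every condition
except orthogonality and fullness is a statement modulo the radical. -/
theorem exists_isBasicFamily (K : Type*) (A : Type*) [Field K] [IsAlgClosed K] [Ring A]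
    [Algebra K A] [FiniteDimensional K A] :
    ∃ (n : ℕ) (e : Fin n → A), IsBasicFamily K (Ring.jacobson A) e := by
  have := IsArtinianRing.of_finite K A
  obtain ⟨n, d, _, ⟨φ⟩⟩ :=
    IsSemisimpleRing.exists_algEquiv_pi_matrix_of_isAlgClosed K (A ⧸ Ring.jacobson A)
  let π : A →ₐ[K] ∀ i, Matrix (Fin (d i)) (Fin (d i)) K :=
    φ.toAlgHom.comp (Ideal.Quotient.mkₐ K (Ring.jacobson A))
  have hπ : Function.Surjective π := φ.surjective.comp Ideal.Quotient.mk_surjective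
  have hker : ∀ x, π x = 0 ↔ x ∈ Ring.jacobson A := fun x => by
    rw [← Ideal.Quotient.eq_zero_iff_mem]
    exact map_eq_zero_iff φ φ.injective
  obtain ⟨N, hN⟩ := IsSemiprimaryRing.isNilpotent (R := A)
  have hnil : ∀ x ∈ Ring.jacobson A, IsNilpotent x := fun x hx =>
    ⟨N, by have := Ideal.pow_mem_pow hx N; rwa [hN] at this⟩
  obtain ⟨e, he, hπe⟩ := (orthogonalIdempotents_single_zero (K := K) (d := d)
    ).lift_of_isNilpotent_ker π.toRingHom (fun x hx => hnil x ((hker x).1 hx)) fun i => hπ _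
  replace hπe : ∀ i, π (e i) = Pi.single i (Matrix.single 0 0 1) := congr_fun hπe
  refine ⟨n, e, he, fun i j hij x => ?_, fun i x => ?_, fun i => ?_, fun i x hx => ?_, ?_⟩
  · rw [← hker, map_mul, map_mul, hπe, hπe, single_zero_mul_mul_single_zero_of_ne hij]
  · refine ⟨π x i 0 0, ?_⟩
    rw [← hker, map_sub, map_smul, map_mul, map_mul, hπe, single_zero_mul_mul_single_zero,
      sub_self]
  · rw [← hker, hπe, Pi.single_eq_zero_iff]
    intro h
    simpa using congr_fun (congr_fun h 0) 0
  · rw [← hker, map_mul, hπe] at hx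
    obtain ⟨y, hy⟩ := exists_single_zero_mul_mul_eq i _ hx
    obtain ⟨y, rfl⟩ := hπ y
    exact ⟨y, by rw [← hker, map_sub, map_mul, map_mul, hπe, hy, sub_self]⟩
  · choose s hs using hπ
    let ε := (Fintype.equivFin (Σ i : Fin n, Fin (d i))).symm
    let x := fun k => s (Pi.single (ε k).1 (Matrix.single (ε k).2 0 1))
    let y := fun k => s (Pi.single (ε k).1 (Matrix.single 0 (ε k).2 1))
    have h1 : 1 - ∑ k, x k * (∑ i, e i) * y k ∈ Ring.jacobson A := by
      rw [← hker, map_sub, map_one, map_sum, sub_eq_zero, ← sum_single_mul_sum_mul_single]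
      simp only [map_mul, map_sum, hπe, x, y, hs]
      exact (ε.sum_comp fun p => (Pi.single p.1 (Matrix.single p.2 0 1) *
        (∑ i, Pi.single i (Matrix.single 0 0 1)) * Pi.single p.1 (Matrix.single 0 p.2 1) :
          ∀ i, Matrix (Fin (d i)) (Fin (d i)) K)).symm
    -- Fullness holds only up to a nilpotent element, so the sum is a unit; its inverse is absorbed
    -- into `y`.
    have h2 := (hnil _ h1).isUnit_one_sub
    rw [sub_sub_cancel] at h2
    obtain ⟨u, hu⟩ := h2
    refine ⟨_, x, fun k => y k * ↑u⁻¹, ?_⟩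
    simp only [← mul_assoc]
    rw [← Finset.sum_mul, ← hu, Units.mul_inv]

/-! ### Homomorphisms from a submodule and extensions of the quotient -/

section Ext

variable {K : Type u} {R : Type v} [Field K] [Ring R] [Algebra K R]
  {P : Type v} [AddCommGroup P] [Module R P]

/-- The short exact sequence `0 → N → P → P / N → 0`. -/
abbrev Submodule.shortComplex (N : Submodule R P) : ShortComplex (ModuleCat.{v} R) :=
  ShortComplex.mk (ModuleCat.ofHom N.subtype) (ModuleCat.ofHom N.mkQ) (by
    ext x; simp)

theorem Submodule.shortExact (N : Submodule R P) : N.shortComplex.ShortExact where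
  exact := by
    rw [ShortComplex.ShortExact.moduleCat_exact_iff_function_exact]
    exact LinearMap.exact_subtype_mkQ N
  mono_f := (ModuleCat.mono_iff_injective _).2 N.injective_subtype
  epi_g := (ModuleCat.epi_iff_surjective _).2 N.mkQ_surjective

/-- If all homomorphisms `P → T` vanish on `N`, then the connecting homomorphism
`Hom(N, T) → Ext¹(P / N, T)` is injective. -/
theorem rank_hom_le_rank_ext (N : Submodule R P) (T : ModuleCat.{v} R)
    (h : ∀ f : P →ₗ[R] T, ∀ x ∈ N, f x = 0) :
    Module.rank K (ModuleCat.of R N ⟶ T) ≤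
      Module.rank K (Abelian.Ext (ModuleCat.of R (P ⧸ N)) T 1) := by
  let δ : (ModuleCat.of R N ⟶ T) →ₗ[K] Abelian.Ext (ModuleCat.of R (P ⧸ N)) T 1 :=
    (Abelian.Ext.bilinearCompOfLinear K _ _ T 1 0 1 rfl N.shortExact.extClass).comp
      (Abelian.Ext.linearEquiv₀ (R := K)).symm.toLinearMap
  refine LinearMap.rank_le_of_injective δ ((injective_iff_map_eq_zero _).2 fun φ hφ => ?_)
  -- By exactness, a `φ` killed by the connecting map extends to `ψ : P → T`, which vanishes on `N`
  -- by hypothesis.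
  obtain ⟨x, hx⟩ := Abelian.Ext.contravariant_sequence_exact₁ N.shortExact T
    (Abelian.Ext.mk₀ φ) rfl hφ
  obtain ⟨ψ, rfl⟩ := Abelian.Ext.addEquiv₀.symm.surjective x
  rw [Abelian.Ext.addEquiv₀_symm_apply, Abelian.Ext.mk₀_comp_mk₀] at hx
  have := Abelian.Ext.addEquiv₀.symm.injective hx
  rw [← this]
  ext y
  exact h ψ.hom _ y.2

theorem linearMap_eq_zero_of_rank_ext_eq_zero (N : Submodule R P) (T : ModuleCat.{v} R)
    (h : ∀ f : P →ₗ[R] T, ∀ x ∈ N, f x = 0)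
    (hr : Module.rank K (Abelian.Ext (ModuleCat.of R (P ⧸ N)) T 1) = 0) (φ : N →ₗ[R] T) :
    φ = 0 := by
  have := rank_zero_iff.1 (le_antisymm (hr ▸ rank_hom_le_rank_ext (K := K) N T h) zero_le)
  exact congrArg ModuleCat.Hom.hom (Subsingleton.elim (ModuleCat.ofHom φ) 0)

theorem exists_forall_eq_smul_of_rank_ext_le_one (N : Submodule R P) (T : ModuleCat.{v} R)
    (h : ∀ f : P →ₗ[R] T, ∀ x ∈ N, f x = 0)
    (hr : Module.rank K (Abelian.Ext (ModuleCat.of R (P ⧸ N)) T 1) ≤ 1) :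
    ∃ θ : N →ₗ[R] T, ∀ φ : N →ₗ[R] T, ∃ c : K, ∀ x, φ x = algebraMap K R c • θ x := by
  obtain ⟨θ, hθ⟩ := rank_le_one_iff.1 ((rank_hom_le_rank_ext (K := K) N T h).trans hr)
  refine ⟨θ.hom, fun φ => ?_⟩
  obtain ⟨c, hc⟩ := hθ (ModuleCat.ofHom φ)
  exact ⟨c, fun x => (congrArg (fun f => f.hom x) hc).symm⟩

end Ext

/-! ### Right modules `e A`, their radicals and simple tops -/

section RightIdeals

variable {A : Type v} [Ring A]

/-- A two-sided ideal as a right ideal. -/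
def Ideal.toRight (J : Ideal A) [J.IsTwoSided] : Submodule Aᵐᵒᵖ A where
  carrier := J
  add_mem' := J.add_mem
  zero_mem' := J.zero_mem
  smul_mem' a _ hx := J.mul_mem_right a.unop hx

/-- The right ideal `e A` for an idempotent `e`. -/
def idemRight (e : A) : Submodule Aᵐᵒᵖ A where
  carrier := {x | e * x = x}
  add_mem' {x y} hx hy := by
    change e * (x + y) = x + y
    rw [mul_add, hx, hy]
  zero_mem' := mul_zero e
  smul_mem' a x hx := by
    change e * (x * a.unop) = x * a.unop
    rw [← mul_assoc, hx]

/-- Such a module is a module over the opposite of `A / J`, and the opposite of a semisimple ring is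
semisimple. -/
theorem isSemisimpleModule_op_of_forall_mul_eq_zero (J : Ideal A) [J.IsTwoSided]
    [IsSemisimpleRing (A ⧸ J)] (M : Type*) [AddCommGroup M] [Module Aᵐᵒᵖ M]
    (h : ∀ a ∈ J, ∀ x : M, MulOpposite.op a • x = 0) : IsSemisimpleModule Aᵐᵒᵖ M := by
  let σ : Aᵐᵒᵖ →+* (A ⧸ J)ᵐᵒᵖ := (Ideal.Quotient.mk J).op
  have hσ : Function.Surjective σ := fun x => by
    obtain ⟨a, ha⟩ := Ideal.Quotient.mk_surjective x.unop
    exact ⟨MulOpposite.op a, MulOpposite.unop_injective ha⟩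
  have : IsSemisimpleRing (Aᵐᵒᵖ ⧸ RingHom.ker σ) :=
    (RingHom.quotientKerEquivOfSurjective hσ).symm.isSemisimpleRing
  have hM : Module.IsTorsionBySet Aᵐᵒᵖ M (RingHom.ker σ) := by
    rintro x ⟨a, ha⟩
    have := MulOpposite.op_injective ha
    exact h a.unop (Ideal.Quotient.eq_zero_iff_mem.1 this) x
  let := hM.module
  exact hM.isSemisimpleModule_iff.1 inferInstance

/-- The right module `e J` for an idempotent `e`. -/
abbrev radRight (J : Ideal A) [J.IsTwoSided] (e : A) : Submodule Aᵐᵒᵖ (idemRight e) :=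
  J.toRight.comap (idemRight e).subtype

/-- The right module `e A / e J`, which is simple if `e` is primitive and `J` is the radical. -/
abbrev TopRight (J : Ideal A) [J.IsTwoSided] (e : A) : Type v :=
  ↥(idemRight e) ⧸ radRight J e

variable (J : Ideal A) [J.IsTwoSided] {e : A}

/-- Any element of `e A` outside `J` can be multiplied back to `e` modulo `J`, so a submodule
strictly above `e J` contains the generator `e`. -/
theorem isSimpleModule_topRight (he : e * e = e) (heJ : e ∉ J)
    (h : ∀ x, e * x ∉ J → ∃ y, e * x * y - e ∈ J) :
    IsSimpleModule Aᵐᵒᵖ (TopRight J e) := by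
  rw [isSimpleModule_iff_isCoatom]
  refine ⟨fun ht => heJ ?_, fun N hN => ?_⟩
  · have : (⟨e, he⟩ : idemRight e) ∈ radRight J e := ht ▸ trivial
    exact this
  · obtain ⟨hle, x, hxN, hxJ⟩ := SetLike.lt_iff_le_and_exists.1 hN
    have hex : e * x.1 = x.1 := x.2
    obtain ⟨y, hy⟩ := h x.1 (by rw [hex]; exact hxJ)
    rw [hex] at hy
    have h1 : MulOpposite.op y • x - ⟨e, he⟩ ∈ N := hle hy
    have h2 : (⟨e, he⟩ : idemRight e) ∈ N :=
      by simpa only [sub_sub_cancel] using sub_mem (N.smul_mem (MulOpposite.op y) hxN) h1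
    rw [eq_top_iff]
    intro z _
    have : z = MulOpposite.op z.1 • (⟨e, he⟩ : idemRight e) := Subtype.ext (Eq.symm z.2)
    rw [this]
    exact N.smul_mem _ h2

/-- The element `f` annihilates `e A / e J` but fixes the nonzero class of `f` in `f A / f J`. -/
theorem not_linearEquiv_topRight {f : A} (hf : f * f = f) (hfJ : f ∉ J)
    (h : ∀ x, e * x * f ∈ J) : IsEmpty (TopRight J e ≃ₗ[Aᵐᵒᵖ] TopRight J f) := by
  refine ⟨fun g => hfJ ?_⟩
  obtain ⟨s, hs⟩ := g.surjective (Submodule.Quotient.mk ⟨f, hf⟩)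
  obtain ⟨x, rfl⟩ := Submodule.Quotient.mk_surjective _ s
  have h0 : MulOpposite.op f • (Submodule.Quotient.mk x : TopRight J e) = 0 := by
    refine (Submodule.Quotient.mk_eq_zero _).2 ?_
    change x.1 * f ∈ J
    rw [← show e * x.1 = x.1 from x.2]
    exact h _
  have h1 : (Submodule.Quotient.mk (MulOpposite.op f • ⟨f, hf⟩) : TopRight J f) = 0 := by
    rw [Submodule.Quotient.mk_smul, ← hs, ← map_smul, h0, map_zero]
  have h2 : f * f ∈ J := (Submodule.Quotient.mk_eq_zero (radRight J f)).1 h1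
  rwa [hf] at h2

/-- For `x` in `e J`, `g x = g (e) x`, and `J` annihilates `f A / f J`. This makes the connecting
map out of `Hom(e J, f A / f J)` injective. -/
theorem hom_topRight_eq_zero (he : e * e = e) {f : A} (g : idemRight e →ₗ[Aᵐᵒᵖ] TopRight J f)
    (x : idemRight e) (hx : x ∈ radRight J e) : g x = 0 := by
  have hx' : x = MulOpposite.op x.1 • (⟨e, he⟩ : idemRight e) := Subtype.ext (Eq.symm x.2)
  rw [hx', map_smul]
  obtain ⟨z, hz⟩ := Submodule.Quotient.mk_surjective _ (g ⟨e, he⟩)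
  rw [← hz]
  exact (Submodule.Quotient.mk_eq_zero _).2 (J.mul_mem_left _ hx)

/-- Elements of `N f`, for a right ideal `N ⊆ J`, that are independent modulo `J²` are separated by
homomorphisms from `N` to the simple module `f A / f J`. -/
theorem exists_hom_topRight {K : Type*} [Field K] [Algebra K A] [IsSemisimpleRing (A ⧸ J)] {f : A}
    (hf : f * f = f) [IsSimpleModule Aᵐᵒᵖ (TopRight J f)] (hfJ : f ∉ J)
    (hc : ∀ x, ∃ c : K, f * x * f - c • f ∈ J) {N : Type*} [AddCommGroup N] [Module Aᵐᵒᵖ N]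
    (i : N →ₗ[Aᵐᵒᵖ] A) (hi : Function.Injective i) (hiJ : ∀ x, i x ∈ J) (y z : N)
    (hy : i y * f = i y) (hz : i z * f = i z) (hyz : ∀ c : K, i y - c • i z ∉ J ^ 2) :
    ∃ φ : N →ₗ[Aᵐᵒᵖ] TopRight J f, φ y ≠ 0 ∧ φ z = 0 := by
  have hsq : ∀ {a b}, a ∈ J → b ∈ J → a * b ∈ J ^ 2 := fun ha hb => by
    rw [Submodule.pow_succ, Submodule.pow_one]
    exact Ideal.mul_mem_mul ha hb
  have his : ∀ a x, i (MulOpposite.op a • x) = i x * a := fun a x => map_smul i _ x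
  -- The quotient by `W` is annihilated by `J`, hence semisimple, while `z` dies in it. It remains
  -- to see that `y` survives and to split off the simple submodule it generates.
  let W : Submodule Aᵐᵒᵖ N := (J ^ 2).toRight.comap i ⊔ Submodule.span _ {z}
  have hW : ∀ x, i x ∈ J ^ 2 → x ∈ W := fun x hx => Submodule.mem_sup_left hx
  have := isSemisimpleModule_op_of_forall_mul_eq_zero J (N ⧸ W) fun a ha x => by
    obtain ⟨x, rfl⟩ := Submodule.Quotient.mk_surjective _ x
    exact (Submodule.Quotient.mk_eq_zero W).2 (hW _ (his a x ▸ hsq (hiJ x) ha))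
  have hyW : y ∉ W := by
    intro hyW
    obtain ⟨s, hs, t, ht, hst⟩ := Submodule.mem_sup.1 hyW
    obtain ⟨a, rfl⟩ := Submodule.mem_span_singleton.1 ht
    have h1 : i y = i s + i z * a.unop := by rw [← hst, map_add, ← his]; rfl
    -- Multiplying `h1` by `f` on the right turns `a` into `f a f`, a scalar multiple of `f` modulo
    -- `J`, contradicting the independence of `y` and `z`.
    obtain ⟨c, hc⟩ := hc a.unop
    refine hyz c ?_
    have h2 : i y - c • i z = i s * f + i z * (f * a.unop * f - c • f) := by
      rw [mul_sub, mul_smul_comm, hz, ← mul_assoc, ← mul_assoc, hz, ← hy, h1, add_mul]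
      abel
    rw [h2]
    exact add_mem ((J ^ 2).mul_mem_right _ hs) (hsq (hiJ z) hc)
  let g₀ : idemRight f →ₗ[Aᵐᵒᵖ] N :=
    { toFun := fun x => MulOpposite.op x.1 • y
      map_add' := fun a b => by
        rw [← add_smul]; rfl
      map_smul' := fun a b => by
        rw [RingHom.id_apply, ← mul_smul]; rfl }
  let g : TopRight J f →ₗ[Aᵐᵒᵖ] N ⧸ W := Submodule.liftQ _ (W.mkQ ∘ₗ g₀) fun x hx =>
    (Submodule.Quotient.mk_eq_zero W).2 (hW _ (his x.1 y ▸ hsq (hiJ y) hx))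
  have hg : g (Submodule.Quotient.mk ⟨f, hf⟩) = Submodule.Quotient.mk y :=
    congrArg Submodule.Quotient.mk (hi ((his f y).trans hy))
  have hg0 : g ≠ 0 := fun h0 => hyW ((Submodule.Quotient.mk_eq_zero W).1 (by
    rw [← hg, h0, LinearMap.zero_apply]))
  -- The map `g` sends the class of `f` to that of `y`. It is injective by simplicity, so it has a
  -- retraction `r`, and `r` after the quotient map separates `y` from `z`.
  obtain ⟨r, hr⟩ := IsSemisimpleModule.extension_property g (LinearMap.injective_of_ne_zero hg0)
    LinearMap.id
  refine ⟨r ∘ₗ W.mkQ, ?_, ?_⟩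
  · rw [LinearMap.comp_apply, Submodule.mkQ_apply, ← hg, ← LinearMap.comp_apply, hr]
    exact fun h0 => hfJ ((Submodule.Quotient.mk_eq_zero (radRight J f)).1 h0)
  · rw [LinearMap.comp_apply, Submodule.mkQ_apply, (Submodule.Quotient.mk_eq_zero W).2
      (Submodule.mem_sup_right (Submodule.mem_span_singleton_self z)), map_zero]

end RightIdeals

/-! ### From bounds on extensions to bounds on `e i (J / J²) e j` -/

section ExtBounds

variable {K : Type u} {A : Type v} [Field K] [Ring A] [Algebra K A] {J : Ideal A} [J.IsTwoSided]
  [IsSemisimpleRing (A ⧸ J)] {ι : Type*} [Fintype ι] {e : ι → A}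

omit [IsSemisimpleRing (A ⧸ J)] in
theorem IsBasicFamily.isSimpleModule (he : IsBasicFamily K J e) (i : ι) :
    IsSimpleModule Aᵐᵒᵖ (TopRight J (e i)) :=
  isSimpleModule_topRight J (he.orthogonal.idem i) (he.notMem i) (he.exists_mul i)

theorem IsBasicFamily.exists_hom (he : IsBasicFamily K J e) (i j : ι) {x y : A} (hx : x ∈ J)
    (hy : y ∈ J) (hxy : ∀ c : K, e i * x * e j - c • (e i * y * e j) ∉ J ^ 2) :
    ∃ (X Y : radRight J (e i)) (φ : radRight J (e i) →ₗ[Aᵐᵒᵖ] TopRight J (e j)),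
      X.1.1 = e i * x * e j ∧ Y.1.1 = e i * y * e j ∧ φ X ≠ 0 ∧ φ Y = 0 := by
  have := he.isSimpleModule j
  have h : ∀ z, e i * (e i * z * e j) = e i * z * e j := fun z => by
    rw [← mul_assoc, ← mul_assoc, he.orthogonal.idem i]
  have h' : ∀ z, e i * z * e j * e j = e i * z * e j := fun z => by
    rw [mul_assoc, he.orthogonal.idem j]
  refine ⟨⟨⟨_, h x⟩, Ideal.mul_mul_mem_of_isTwoSided hx _ _⟩,
    ⟨⟨_, h y⟩, Ideal.mul_mul_mem_of_isTwoSided hy _ _⟩, ?_⟩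
  let incl : radRight J (e i) →ₗ[Aᵐᵒᵖ] A :=
    (idemRight (e i)).subtype ∘ₗ (radRight J (e i)).subtype
  obtain ⟨φ, h1, h2⟩ := exists_hom_topRight J (he.orthogonal.idem j) (he.notMem j)
    (he.exists_smul j) incl
    (Subtype.val_injective.comp Subtype.val_injective) (fun x : radRight J (e i) => x.2)
    ⟨⟨_, h x⟩, Ideal.mul_mul_mem_of_isTwoSided hx _ _⟩
    ⟨⟨_, h y⟩, Ideal.mul_mul_mem_of_isTwoSided hy _ _⟩ (h' x) (h' y) hxy
  exact ⟨φ, rfl, rfl, h1, h2⟩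

/-- An element outside `J²` would be detected by a nonzero map `e i J → S j`; this is separation
from zero. -/
theorem IsBasicFamily.mul_mul_mem_sq (he : IsBasicFamily K J e) (i j : ι)
    (h : Module.rank K (Abelian.Ext (ModuleCat.of Aᵐᵒᵖ (TopRight J (e i)))
        (ModuleCat.of Aᵐᵒᵖ (TopRight J (e j))) 1) = 0) {x : A} (hx : x ∈ J) :
    e i * x * e j ∈ J ^ 2 := by
  by_contra hn
  obtain ⟨X, -, φ, -, -, hX, -⟩ := he.exists_hom i j hx (zero_mem J) fun c => by
    rwa [mul_zero, zero_mul, smul_zero, sub_zero]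
  exact hX (LinearMap.congr_fun (linearMap_eq_zero_of_rank_ext_eq_zero (radRight J (e i))
    (ModuleCat.of Aᵐᵒᵖ (TopRight J (e j)))
    (fun f x hx => hom_topRight_eq_zero J (he.orthogonal.idem i) f x hx) h φ) X)

/-- Were `X` independent of `Y` modulo `J²`, some `φ` would kill `Y` but not `X`, and some `ψ` would
not kill `Y`. Both are multiples of one `θ`; since `φ ≠ 0`, `θ` kills `Y`, and so does `ψ`. -/
theorem IsBasicFamily.exists_forall_sub_smul_mem_sq (he : IsBasicFamily K J e) (i j : ι)
    (h : Module.rank K (Abelian.Ext (ModuleCat.of Aᵐᵒᵖ (TopRight J (e i)))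
        (ModuleCat.of Aᵐᵒᵖ (TopRight J (e j))) 1) ≤ 1) :
    ∃ y ∈ J, ∀ x ∈ J, ∃ c : K, e i * x * e j - c • (e i * y * e j) ∈ J ^ 2 := by
  by_cases h0 : ∀ x ∈ J, e i * x * e j ∈ J ^ 2
  · exact ⟨0, zero_mem J, fun x hx => ⟨0, by rw [zero_smul, sub_zero]; exact h0 x hx⟩⟩
  push Not at h0
  obtain ⟨y, hy, hyJ⟩ := h0
  refine ⟨y, hy, fun x hx => ?_⟩
  by_contra! hc
  obtain ⟨Y, -, ψ, hYy, -, hψ, -⟩ := he.exists_hom i j hy (zero_mem J) fun c => by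
    rwa [mul_zero, zero_mul, smul_zero, sub_zero]
  obtain ⟨X, Y', φ, -, hYy', hX, hY⟩ := he.exists_hom i j hx hy hc
  obtain rfl : Y' = Y := Subtype.ext (Subtype.ext (hYy'.trans hYy.symm))
  obtain ⟨θ, hθ⟩ := exists_forall_eq_smul_of_rank_ext_le_one (radRight J (e i))
    (ModuleCat.of Aᵐᵒᵖ (TopRight J (e j)))
    (fun f x hx => hom_topRight_eq_zero J (he.orthogonal.idem i) f x hx) h
  obtain ⟨a, ha⟩ := hθ φ
  obtain ⟨b, hb⟩ := hθ ψ
  have ha0 : a ≠ 0 := by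
    rintro rfl
    exact hX ((ha X).trans (by rw [map_zero, zero_smul]))
  have hθY : θ Y' = 0 := by
    rw [← one_smul Aᵐᵒᵖ (θ Y'), ← map_one (algebraMap K Aᵐᵒᵖ), ← inv_mul_cancel₀ ha0, map_mul,
      mul_smul, ← ha]
    exact (congrArg _ hY).trans (smul_zero _)
  exact hψ ((hb Y').trans (by rw [hθY, smul_zero]))

end ExtBounds

theorem theorem1p1 (K : Type u) [Field K] [IsAlgClosed K]
    (A : Type v) [Ring A] [Algebra K A] [FiniteDimensional K A]
    (hloop : ∀ S : ModuleCat.{v} Aᵐᵒᵖ, IsSimpleModule Aᵐᵒᵖ S →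
      Module.rank K (Abelian.Ext S S 1) = 0)
    (hparallel : ∀ S T : ModuleCat.{v} Aᵐᵒᵖ, IsSimpleModule Aᵐᵒᵖ S → IsSimpleModule Aᵐᵒᵖ T →
      IsEmpty (S ≅ T) → Module.rank K (Abelian.Ext S T 1) ≤ 1) :
    IsStronglySolvable K (Hochschild.HH1 K A) ∧
      LieAlgebra.IsSolvable (Hochschild.HH1 K A) := by
  have := IsArtinianRing.of_finite K A
  obtain ⟨N, hN⟩ := IsSemiprimaryRing.isNilpotent (R := A)
  obtain ⟨n, e, he⟩ := exists_isBasicFamily K A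
  have h : IsStronglySolvable K (Hochschild.HH1 K A) := by
    refine Hochschild.isStronglySolvable_HH1 he (fun i x hx => ?_) (fun i j hij => ?_) hN
    · exact he.mul_mul_mem_sq i i (hloop _ (he.isSimpleModule i)) hx
    · refine he.exists_forall_sub_smul_mem_sq i j
        (hparallel _ _ (he.isSimpleModule i) (he.isSimpleModule j) ⟨fun f => ?_⟩)
      exact (not_linearEquiv_topRight (Ring.jacobson A) (he.orthogonal.idem j) (he.notMem j)
        (he.mul_mul_mem i j hij)).false f.toLinearEquiv
  exact ⟨h, h.isSolvable⟩
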